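/- A Dyck word of length $N$ ($N$ even) is a word $\sigma=\sigma(1)\cdots\sigma(N)$ over the symbols $+$ (opening bracket) and $-$ (closing bracket) with as many $+$ as $-$, in which no prefix contains more $-$ than $+$. Let $$Z(1)={+}{-},\qquad Z(n+1)={+}\,Z(n)\,Z(n)\,{-}\quad(n\ge 1).$$ A re-pairing of $\sigma$ is a sequence of pairs $p=(p_1,\dots,p_{N/2})$, $p_i=(\ell_i,r_i)$, such that $\sigma(\ell_i)=+$, $\sigma(r_i)=-$ and $\ell_i<r_i$ for all $i$, and every number in $\{1,\dots,N\}$ occurs in exactly one pair. For $0\le t\le N/2$ put $B_t(p)=\{\ell_i,r_i : i\le t\}$. The width of a finite set $S$ of integers is the smallest number of integer intervals $[a,b]=\{x\in\mathbb Z: a\le x\le b\}$ whose union is $S$. The width of $p$ is the maximum over $t$ of the width of $B_t(p)$, and $\operatorname{width}(\sigma)$ is the minimum of the widths of the re-pairings of $\sigma$. Theorem. $\operatorname{width}(Z(n))=2^{O(\sqrt{\log n})}$; that is, there is a constant $C$ such that for all integers $n\ge 2$, $$\operatorname{width}(Z(n))\le 2^{\,C\sqrt{\log_2 n}}.$$ 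-/

import Mathlib

namespace BracketRepairing

/-- The words `Z(n)`: `Z(n+1) = + Z(n) Z(n) -`, starting from the empty word `Z(0)`,
so that `Z(1) = + -`. Here `+` is `DyckStep.U`, `-` is `DyckStep.D`, the sum of Dyck words
is concatenation and `nest` encloses a word in one pair of brackets. -/
def Z : ℕ → DyckWord
  | 0 => 0
  | n + 1 => (Z n + Z n).nest

/-- `p = (p₁, …, p_{N/2})`, a sequence of pairs `(ℓ, r)` of positions, is a re-pairing of the
Dyck word `σ` of length `N`. Positions are numbered `0, …, N - 1`. -/
structure IsRepairing (σ : DyckWord) (p : List (ℕ × ℕ)) : Prop where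
  /-- there are `N / 2` pairs -/
  two_mul_length : 2 * p.length = σ.toList.length
  /-- the first position of each pair carries a plus -/
  plus : ∀ x ∈ p, σ.toList[x.1]? = some DyckStep.U
  /-- the second position of each pair carries a minus -/
  minus : ∀ x ∈ p, σ.toList[x.2]? = some DyckStep.D
  /-- the plus precedes the minus -/
  lt : ∀ x ∈ p, x.1 < x.2
  /-- every position occurs in exactly one pair -/
  cover : ∀ b < σ.toList.length, ∃! i : Fin p.length, b = (p.get i).1 ∨ b = (p.get i).2

/-- The set `B_t(p)` of the positions erased by the first `t` pairs of `p`. -/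
def erased (p : List (ℕ × ℕ)) (t : ℕ) : Set ℕ :=
  {b | ∃ x ∈ p.take t, b = x.1 ∨ b = x.2}

/-- The width of a (finite) set `S` of integers: the smallest number of intervals `[a, b]`
whose union is `S`. -/
noncomputable def setWidth (S : Set ℕ) : ℕ :=
  sInf {m : ℕ | ∃ a b : Fin m → ℕ, S = ⋃ i, Set.Icc (a i) (b i)}

/-- The width of a sequence of pairs: the maximum over time `t` of the width of the set of the
positions erased up to time `t`. (The time `t = 0` contributes the width `0` of `∅`.) -/
noncomputable def repairingWidth (p : List (ℕ × ℕ)) : ℕ :=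
  (Finset.range (p.length + 1)).sup fun t => setWidth (erased p t)

/-- The width of a Dyck word: the minimum width of its re-pairings. -/
noncomputable def width (σ : DyckWord) : ℕ :=
  sInf {w : ℕ | ∃ p : List (ℕ × ℕ), IsRepairing σ p ∧ repairingWidth p = w}

end BracketRepairing

namespace BracketRepairing

open Finset

/-! ### Intervals and runs -/

/-! Read the word from left to right, keeping unmatched pluses on a stack and matching each minus at
once with a plus from it. The erased set is then the prefix read minus the stack, so its width is at
most the number of runs of the stack plus one (`setWidth_compl_le`). It remains to choose the pluses
so that the stack has few runs.

The stack is `B ++ A`: `B` is frozen, and minuses take the oldest plus of `A`. The part `A` stays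
superincreasing, hence has only logarithmically many runs. To erase `Z D` on top of `A`
(`Reach.append_Z`), compare `D` with `s = A.length`. If `D < s`, freeze `A` and start afresh: this
costs logarithmically many runs, but `D` is less than half of `A.length + D`. If `D ≥ s`, push the
first `s` pluses, which doubles `A`, and recurse along the right arm; its `s` minuses use up the old
`A`. These recursive calls keep `A.length + D` constant. So freezing nests only logarithmically
deep, and the width is `O((log n)^2)`, stronger than required. -/

theorem setWidth_le_card {S : Set ℕ} (T : Finset ℕ) (e : ℕ → ℕ)
    (h : S = ⋃ a ∈ T, Set.Icc a (e a)) : setWidth S ≤ T.card := by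
  refine Nat.sInf_le ⟨fun i => (T.equivFin.symm i : ℕ), fun i => e (T.equivFin.symm i), ?_⟩
  rw [h]
  ext x
  simp only [Set.mem_iUnion]
  constructor
  · rintro ⟨a, ha, hx⟩
    exact ⟨T.equivFin ⟨a, ha⟩, by simpa using hx⟩
  · rintro ⟨i, hx⟩
    exact ⟨_, (T.equivFin.symm i).2, hx⟩

/-- The number of maximal runs of consecutive integers in a list. -/
def runs (l : List ℕ) : ℕ := (l.toFinset.filter fun x => x + 1 ∉ l).card

theorem runs_nil : runs [] = 0 := rfl

theorem runs_append_le (l m : List ℕ) : runs (l ++ m) ≤ runs l + runs m := by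
  refine (Finset.card_le_card ?_).trans (Finset.card_union_le _ _)
  intro x
  simp only [mem_filter, List.mem_toFinset, List.mem_append, mem_union]
  tauto

theorem runs_range'_le (a m : ℕ) : runs (List.range' a m) ≤ 1 := by
  refine (Finset.card_le_card (t := {a + m - 1}) ?_).trans (by simp)
  intro x
  simp only [mem_filter, List.mem_toFinset, List.mem_range'_1, mem_singleton]
  omega

/-- The complement of a list in an initial segment has at most one interval more than the list
has runs. -/
theorem setWidth_compl_le (q : ℕ) (l : List ℕ) :
    setWidth {b | b < q ∧ b ∉ l} ≤ runs l + 1 := by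
  classical
  set T := (range q).filter fun a => a ∉ l ∧ (a = 0 ∨ a - 1 ∈ l) with hT
  have hcard : T.card ≤ runs l + 1 := by
    -- A left end of a complementary interval is 0 or the successor of the right end of a run of
    -- `l`.
    refine (Finset.card_le_card
      (t := insert 0 ((l.toFinset.filter fun x => x + 1 ∉ l).image (· + 1))) ?_).trans
      ((Finset.card_insert_le _ _).trans (Nat.succ_le_succ Finset.card_image_le))
    intro a ha
    simp only [hT, mem_filter, mem_range] at ha
    obtain ⟨-, hal, h0 | h1⟩ := ha
    · simp [h0]
    · rcases Nat.eq_zero_or_pos a with h0 | hpos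
      · simp [h0]
      · simp only [mem_insert, mem_image, mem_filter, List.mem_toFinset]
        have : a - 1 + 1 = a := by omega
        exact Or.inr ⟨a - 1, ⟨h1, by rwa [this]⟩, this⟩
  refine (setWidth_le_card T
    (fun a => ((range q).filter fun b => ∀ c, a ≤ c → c ≤ b → c ∉ l).sup id) ?_).trans hcard
  ext b
  simp only [Set.mem_ofPred_eq, Set.mem_iUnion, Set.mem_Icc, exists_prop]
  constructor
  · rintro ⟨hbq, hbl⟩
    have hex : ∃ a, a ≤ b ∧ ∀ c, a ≤ c → c ≤ b → c ∉ l :=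
      ⟨b, le_rfl, fun c h1 h2 => by rwa [le_antisymm h2 h1]⟩
    obtain ⟨hab, hfree⟩ := Nat.find_spec hex
    set a := Nat.find hex with ha
    refine ⟨a, ?_, hab, ?_⟩
    · simp only [hT, mem_filter, mem_range]
      refine ⟨by omega, hfree a le_rfl hab, ?_⟩
      by_contra! hcon
      refine Nat.find_min hex (m := a - 1) (by omega) ⟨by omega, fun c h1 h2 => ?_⟩
      rcases Nat.lt_or_ge c a with hca | hca
      · rw [show c = a - 1 by omega]
        exact hcon.2
      · exact hfree c hca h2
    · exact Finset.le_sup (f := id) (mem_filter.2 ⟨mem_range.2 hbq, hfree⟩)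
  · rintro ⟨a, haT, hab, hb⟩
    simp only [hT, mem_filter, mem_range] at haT
    obtain ⟨m, hm, hsup⟩ := Finset.exists_mem_eq_sup
      ((range q).filter fun b => ∀ c, a ≤ c → c ≤ b → c ∉ l)
      ⟨a, mem_filter.2 ⟨mem_range.2 haT.1, fun c h1 h2 => by
        rw [le_antisymm h2 h1]; exact haT.2.1⟩⟩ id
    rw [hsup] at hb
    simp only [mem_filter, mem_range, id] at hm hb
    exact ⟨by omega, hm.2 b hab hb⟩

/-! ### Re-pairing a word from left to right -/

/-- The pairs `p` have erased all of the word `w` except for the pluses at the positions in `S`,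
with widths at most `k`. -/
structure Partial (k : ℕ) (w : List DyckStep) (S : List ℕ) (p : List (ℕ × ℕ)) : Prop where
  mem_plus : ∀ x ∈ S, w[x]? = some DyckStep.U
  nodup : S.Nodup
  plus : ∀ x ∈ p, w[x.1]? = some DyckStep.U
  minus : ∀ x ∈ p, w[x.2]? = some DyckStep.D
  lt : ∀ x ∈ p, x.1 < x.2
  two_mul_length : 2 * p.length + S.length = w.length
  mem_iff : ∀ b, (∃ x ∈ p, b = x.1 ∨ b = x.2) ↔ b < w.length ∧ b ∉ S
  disjoint : p.Pairwise fun x y => ∀ b, (b = x.1 ∨ b = x.2) → ¬ (b = y.1 ∨ b = y.2)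
  width_le : ∀ t ≤ p.length, setWidth (erased p t) ≤ k

theorem setWidth_empty : setWidth ∅ = 0 :=
  Nat.le_zero.1 (Nat.sInf_le ⟨Fin.elim0, Fin.elim0, by simp⟩)

theorem getElem?_append_of_some {α : Type*} {w : List α} {i : ℕ} {a : α} (v : List α)
    (h : w[i]? = some a) : (w ++ v)[i]? = some a := by
  rw [List.getElem?_append_left, h]
  exact (List.getElem?_eq_some_iff.1 h).1

theorem Partial.nil (k : ℕ) : Partial k [] [] [] where
  mem_plus := by simp
  nodup := by simp
  plus := by simp
  minus := by simp
  lt := by simp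
  two_mul_length := rfl
  mem_iff := by simp
  disjoint := List.Pairwise.nil
  width_le t _ := by simp [erased, setWidth_empty]

theorem Partial.lt_length {k : ℕ} {w : List DyckStep} {S : List ℕ} {p : List (ℕ × ℕ)}
    (h : Partial k w S p) {x : ℕ} (hx : x ∈ S) : x < w.length :=
  (List.getElem?_eq_some_iff.1 (h.mem_plus x hx)).1

theorem Partial.push {k : ℕ} {w : List DyckStep} {S : List ℕ} {p : List (ℕ × ℕ)}
    (h : Partial k w S p) : Partial k (w ++ [DyckStep.U]) (S ++ [w.length]) p where
  mem_plus x hx := by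
    rcases List.mem_append.1 hx with hx | hx
    · exact getElem?_append_of_some _ (h.mem_plus x hx)
    · simp [List.mem_singleton.1 hx]
  nodup := by
    refine List.nodup_append.2 ⟨h.nodup, by simp, fun a ha b hb => ?_⟩
    rw [List.mem_singleton.1 hb]
    exact (h.lt_length ha).ne
  plus x hx := getElem?_append_of_some _ (h.plus x hx)
  minus x hx := getElem?_append_of_some _ (h.minus x hx)
  lt := h.lt
  two_mul_length := by
    have := h.two_mul_length
    simp only [List.length_append, List.length_singleton]
    omega
  mem_iff b := by
    rw [h.mem_iff]
    simp only [List.length_append, List.length_singleton, List.mem_append, List.mem_singleton]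
    grind
  disjoint := h.disjoint
  width_le := h.width_le

/-- Only the last time is new; there the erased set is the complement of the stack in the prefix. -/
theorem Partial.pop {k : ℕ} {w : List DyckStep} {B A : List ℕ} {x : ℕ} {p : List (ℕ × ℕ)}
    (h : Partial k w (B ++ x :: A) p) (hk : runs (B ++ A) + 1 ≤ k) :
    Partial k (w ++ [DyckStep.D]) (B ++ A) (p ++ [(x, w.length)]) := by
  have hx : x ∈ B ++ x :: A := by simp
  have hxw := h.lt_length hx
  have hsub : ∀ y ∈ B ++ A, y ∈ B ++ x :: A := fun y hy => by
    simp only [List.mem_append, List.mem_cons] at hy ⊢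
    tauto
  have hnd : (x :: (B ++ A)).Nodup := List.nodup_middle.1 h.nodup
  have hmem : ∀ b, (∃ y ∈ p ++ [(x, w.length)], b = y.1 ∨ b = y.2) ↔
      b < (w ++ [DyckStep.D]).length ∧ b ∉ B ++ A := by
    intro b
    have hxn := (List.nodup_cons.1 hnd).1
    have hwn : w.length ∉ B ++ A := fun hb => (h.lt_length (hsub _ hb)).ne rfl
    have hb := h.mem_iff b
    simp only [List.mem_append, List.mem_cons, List.not_mem_nil, or_false, or_and_right, exists_or,
      exists_eq_left, List.length_append, List.length_singleton] at hb hxn hwn ⊢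
    rw [hb]
    constructor
    · rintro (⟨h1, h2⟩ | rfl | rfl)
      · exact ⟨by omega, by tauto⟩
      · exact ⟨by omega, hxn⟩
      · exact ⟨by omega, hwn⟩
    · rintro ⟨h1, h2⟩
      by_cases hbx : b = x
      · exact Or.inr (Or.inl hbx)
      · by_cases hbw : b = w.length
        · exact Or.inr (Or.inr hbw)
        · exact Or.inl ⟨by omega, by tauto⟩
  refine ⟨fun y hy => getElem?_append_of_some _ (h.mem_plus y (hsub y hy)),
    (List.nodup_cons.1 hnd).2, ?_, ?_, ?_, ?_, hmem, ?_, ?_⟩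
  · intro y hy
    rcases List.mem_append.1 hy with hy | hy
    · exact getElem?_append_of_some _ (h.plus y hy)
    · rw [List.mem_singleton.1 hy]
      exact getElem?_append_of_some _ (h.mem_plus x hx)
  · intro y hy
    rcases List.mem_append.1 hy with hy | hy
    · exact getElem?_append_of_some _ (h.minus y hy)
    · simp [List.mem_singleton.1 hy]
  · intro y hy
    rcases List.mem_append.1 hy with hy | hy
    · exact h.lt y hy
    · rw [List.mem_singleton.1 hy]
      exact hxw
  · have := h.two_mul_length
    simp only [List.length_append, List.length_cons, List.length_nil] at this ⊢
    omega
  · refine List.pairwise_append.2 ⟨h.disjoint, List.pairwise_singleton _ _, ?_⟩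
    intro y hy z hz b hb hbz
    obtain ⟨h1, h2⟩ := (h.mem_iff b).1 ⟨y, hy, hb⟩
    rw [List.mem_singleton.1 hz] at hbz
    rcases hbz with rfl | rfl
    · exact h2 hx
    · exact lt_irrefl _ h1
  · intro t ht
    rcases Nat.lt_or_ge p.length t with hlt | hle
    · have hS : erased (p ++ [(x, w.length)]) t =
          {b | b < (w ++ [DyckStep.D]).length ∧ b ∉ B ++ A} := by
        ext b
        rw [erased, List.take_of_length_le (by simpa using hlt)]
        exact hmem b
      rw [hS]
      exact (setWidth_compl_le _ _).trans hk
    · rw [erased, List.take_append_of_le_length hle]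
      exact h.width_le t hle

theorem Partial.isRepairing {k : ℕ} {σ : DyckWord} {p : List (ℕ × ℕ)}
    (h : Partial k σ.toList [] p) : IsRepairing σ p where
  two_mul_length := h.two_mul_length
  plus := h.plus
  minus := h.minus
  lt := h.lt
  cover b hb := by
    obtain ⟨x, hx, hbx⟩ := (h.mem_iff b).2 ⟨hb, by simp⟩
    obtain ⟨i, rfl⟩ := List.mem_iff_get.1 hx
    refine ⟨i, hbx, fun j hbj => ?_⟩
    have hd := List.pairwise_iff_get.1 h.disjoint
    rcases lt_trichotomy i j with hij | hij | hij
    · exact absurd hbj (hd i j hij b hbx)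
    · exact hij.symm
    · exact absurd hbx (hd j i hij b hbj)

/-- A left-to-right strategy can erase all of `w` except for the pluses at the positions in `S`,
with widths at most `k`. -/
def Reach (k : ℕ) (w : List DyckStep) (S : List ℕ) : Prop := ∃ p, Partial k w S p

theorem Reach.width_le {k : ℕ} {σ : DyckWord} (h : Reach k σ.toList []) : width σ ≤ k := by
  obtain ⟨p, hp⟩ := h
  refine (Nat.sInf_le ⟨p, hp.isRepairing, rfl⟩ : width σ ≤ repairingWidth p).trans ?_
  exact Finset.sup_le fun t ht => hp.width_le t (by simpa [Nat.lt_succ_iff] using ht)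

theorem Reach.push_replicate {k : ℕ} {w : List DyckStep} {S : List ℕ} (h : Reach k w S) (s : ℕ) :
    Reach k (w ++ List.replicate s DyckStep.U) (S ++ List.range' w.length s) := by
  induction s with
  | zero => simpa using h
  | succ s ih =>
    obtain ⟨p, hp⟩ := ih
    refine ⟨p, ?_⟩
    have := hp.push
    simpa [List.replicate_succ', List.range'_1_concat] using this

theorem Reach.pop {k : ℕ} {w : List DyckStep} {B A : List ℕ} (h : Reach k w (B ++ A))
    (hA : A ≠ []) (hk : runs (B ++ A.tail) + 1 ≤ k) :
    Reach k (w ++ [DyckStep.D]) (B ++ A.tail) := by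
  obtain ⟨p, hp⟩ := h
  obtain ⟨x, A, rfl⟩ := List.exists_cons_of_ne_nil hA
  exact ⟨_, hp.pop hk⟩

/-! ### Superincreasing stacks -/

/-- A list composed of intervals, each at least as long as all the previous ones together. -/
inductive Superincreasing : List ℕ → Prop
  | nil : Superincreasing []
  | append {A : List ℕ} (a m : ℕ) (hA : Superincreasing A) (hm : A.length ≤ m) :
      Superincreasing (A ++ List.range' a m)

theorem Superincreasing.range' (a m : ℕ) : Superincreasing (List.range' a m) := by
  simpa using Superincreasing.nil.append a m (Nat.zero_le m)

/-- Removing the oldest plus only shrinks what later intervals must dominate. -/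
theorem Superincreasing.tail {A : List ℕ} (h : Superincreasing A) : Superincreasing A.tail := by
  induction h with
  | nil => exact .nil
  | @append A a m hA hm ih =>
    rcases A with _ | ⟨x, A⟩
    · rw [List.nil_append, List.tail_range']
      exact .range' _ _
    · exact ih.append a m (by simp only [List.length_cons] at hm; simp; omega)

theorem Superincreasing.drop {A : List ℕ} (h : Superincreasing A) (j : ℕ) :
    Superincreasing (A.drop j) := by
  induction j with
  | zero => exact h
  | succ j ih => rw [← List.tail_drop]; exact ih.tail

/-- Each interval appended to a nonempty list at least doubles the length and adds at most one run.
-/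
theorem Superincreasing.two_pow_runs_le {A : List ℕ} (h : Superincreasing A) (hA : A ≠ []) :
    2 ^ runs A ≤ 2 * A.length := by
  induction h with
  | nil => exact absurd rfl hA
  | @append A a m hA' hm ih =>
    have h1 := runs_range'_le a m
    by_cases h0 : A = []
    · subst h0
      have hm0 : m ≠ 0 := by rintro rfl; simp at hA
      simp only [List.nil_append, List.length_range']
      calc 2 ^ runs (List.range' a m) ≤ 2 ^ 1 := Nat.pow_le_pow_right (by norm_num) h1
        _ ≤ 2 * m := by omega
    · calc 2 ^ runs (A ++ List.range' a m) ≤ 2 ^ (runs A + 1) :=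
            Nat.pow_le_pow_right (by norm_num) ((runs_append_le _ _).trans (by omega))
        _ = 2 * 2 ^ runs A := by ring
        _ ≤ 2 * (2 * A.length) := Nat.mul_le_mul_left 2 (ih h0)
        _ ≤ 2 * (A ++ List.range' a m).length := by
            simp only [List.length_append, List.length_range']; omega

theorem Superincreasing.runs_le {A : List ℕ} (h : Superincreasing A) {N : ℕ}
    (hN : A.length ≤ N) : runs A ≤ Nat.log 2 N + 1 := by
  by_cases hA : A = []
  · simp [hA, runs_nil]
  · have hpos := List.length_pos_iff.2 hA
    have h2 : 2 ^ runs A ≤ N * 2 := (h.two_pow_runs_le hA).trans (by omega)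
    rw [← Nat.log_mul_base (by norm_num) (by omega)]
    exact Nat.le_log_of_pow_le (by norm_num) h2

/-! ### The words `Z(n)` -/

theorem toList_Z_zero : (Z 0).toList = [] := rfl

theorem toList_Z_succ (n : ℕ) :
    (Z (n + 1)).toList = [DyckStep.U] ++ (Z n).toList ++ (Z n).toList ++ [DyckStep.D] := by
  change [DyckStep.U] ++ ((Z n).toList ++ (Z n).toList) ++ [DyckStep.D] = _
  simp

/-- The product of the words `Z(d + i) -` for `i < j`. -/
def rightArm (d : ℕ) : ℕ → List DyckStep
  | 0 => []
  | j + 1 => rightArm d j ++ (Z (d + j)).toList ++ [DyckStep.D]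

theorem toList_Z_add (d s : ℕ) :
    (Z (d + s)).toList = List.replicate s DyckStep.U ++ (Z d).toList ++ rightArm d s := by
  induction s with
  | zero => simp [rightArm]
  | succ s ih =>
    rw [← Nat.add_assoc, toList_Z_succ, rightArm]
    nth_rw 1 [ih]
    simp [List.replicate_succ]

/-- The number of runs that suffices to erase `Z(D)` on top of a stack of height `N - D`. -/
def cost (N : ℕ) : ℕ := (Nat.log 2 N + 2) ^ 2

theorem log_add_two_le_cost (N : ℕ) : Nat.log 2 N + 2 ≤ cost N := by
  unfold cost; nlinarith

/-- Pays for freezing a stack: halving lowers the logarithm by one, and consecutive squares differ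
by more than the runs of the frozen part. -/
theorem cost_add_log_le {D N : ℕ} (hD : D ≠ 0) (h : D * 2 ≤ N) :
    cost D + (Nat.log 2 N + 1) ≤ cost N := by
  have h1 : Nat.log 2 D + 1 ≤ Nat.log 2 N := by
    rw [← Nat.log_mul_base (by norm_num) hD]
    exact Nat.log_mono_right h
  unfold cost
  nlinarith

/-! ### The recursive erasing strategy -/

theorem Reach.pop_superincreasing {k N : ℕ} {w : List DyckStep} {B A : List ℕ}
    (h : Reach k w (B ++ A)) (hA : A ≠ []) (hs : Superincreasing A) (hN : A.length ≤ N)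
    (hk : runs B + cost N ≤ k) : Reach k (w ++ [DyckStep.D]) (B ++ A.tail) := by
  refine h.pop hA ?_
  have h1 := runs_append_le B A.tail
  have h2 := hs.tail.runs_le (N := N) (by simp; omega)
  have h3 := log_add_two_le_cost N
  omega

/-- The words `Z(D)` can be erased on top of a superincreasing stack `A`, after which the stack
is either the same or a single interval of the same length. -/
theorem Reach.append_Z {k : ℕ} (D : ℕ) : ∀ {w : List DyckStep} {B A : List ℕ},
    Superincreasing A → runs B + cost (A.length + D) ≤ k → Reach k w (B ++ A) →
    ∃ A', Reach k (w ++ (Z D).toList) (B ++ A') ∧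
      (A' = A ∨ ∃ a, A' = List.range' a A.length) := by
  induction D using Nat.strong_induction_on with
  | _ D IH =>
  -- With nothing active, the outer plus forms a one-element stack, which the outer minus finally
  -- removes.
  have fresh : ∀ {w : List DyckStep} {B : List ℕ}, runs B + cost D ≤ k → Reach k w B →
      Reach k (w ++ (Z D).toList) B := by
    intro w B hk h
    rcases D with _ | D
    · simpa [toList_Z_zero] using h
    have hk' : runs B + cost (1 + D) ≤ k := by rwa [Nat.add_comm 1 D]
    have shape : ∀ {a : ℕ} {A' : List ℕ}, (A' = List.range' a 1 ∨
        ∃ b, A' = List.range' b (List.range' a 1).length) → ∃ b, A' = List.range' b 1 := by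
      rintro a A' (rfl | ⟨b, rfl⟩)
      exacts [⟨a, rfl⟩, ⟨b, by simp⟩]
    obtain ⟨A₁, h₁, hA₁⟩ := IH D (Nat.lt_succ_self D) (.range' _ 1) (by simpa using hk')
      (h.push_replicate 1)
    obtain ⟨a, rfl⟩ := shape hA₁
    obtain ⟨A₂, h₂, hA₂⟩ := IH D (Nat.lt_succ_self D) (.range' _ 1) (by simpa using hk') h₁
    obtain ⟨b, rfl⟩ := shape hA₂
    have h₃ := h₂.pop_superincreasing (N := 1 + D) (by simp) (.range' _ 1) (by simp) hk'
    simpa [toList_Z_succ] using h₃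
  intro w B A hA hk h
  rcases Nat.lt_or_ge D A.length with hlt | hle
  · rcases Nat.eq_zero_or_pos D with rfl | hD
    · exact ⟨A, by simpa [toList_Z_zero] using h, Or.inl rfl⟩
    -- Here `A` is frozen: `B ++ A` takes the role of `B`.
    · refine ⟨A, fresh ?_ h, Or.inl rfl⟩
      have h1 := runs_append_le B A
      have h2 := hA.runs_le (N := A.length + D) (by omega)
      have h3 := cost_add_log_le hD.ne' (N := A.length + D) (by omega)
      omega
  by_cases h0 : A = []
  · subst h0
    exact ⟨[], by simpa using fresh (by simpa using hk) (by simpa using h), Or.inl rfl⟩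
  have hpos := List.length_pos_iff.2 h0
  obtain ⟨d, rfl⟩ := Nat.exists_eq_add_of_le' hle
  set s := A.length with hs
  set A₀ := A ++ List.range' w.length s with hA₀
  have hlen₀ : A₀.length = 2 * s := by simp [hA₀, ← hs]; omega
  have hsup₀ : Superincreasing A₀ := hA.append _ _ le_rfl
  -- After `j` minuses the stack has `2 * s - j` pluses and the next word is `Z (d + j)`, so height
  -- plus index stays `s + (d + s)` and the budget `k` still suffices.
  have loop : ∀ j ≤ s, ∃ A', Reach k
      (w ++ List.replicate s DyckStep.U ++ (Z d).toList ++ rightArm d j) (B ++ A') ∧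
      (A' = A₀.drop j ∨ ∃ a, A' = List.range' a (2 * s - j)) := by
    intro j
    induction j with
    | zero =>
      intro _
      obtain ⟨A', h', hA'⟩ := IH d (by omega) (B := B) hsup₀
        (by rwa [hlen₀, show 2 * s + d = s + (d + s) by omega])
        (by simpa [hA₀] using h.push_replicate s)
      exact ⟨A', by simpa [rightArm] using h', by simpa [hlen₀] using hA'⟩
    | succ j ih =>
      intro hj
      obtain ⟨A₁, h₁, hA₁⟩ := ih (by omega)
      have hlen₁ : A₁.length = 2 * s - j := by
        rcases hA₁ with rfl | ⟨a, rfl⟩ <;> simp [hlen₀]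
      have hsup₁ : Superincreasing A₁ := by
        rcases hA₁ with rfl | ⟨a, rfl⟩
        exacts [hsup₀.drop j, .range' _ _]
      obtain ⟨A₂, h₂, hA₂⟩ := IH (d + j) (by omega) hsup₁
        (by rwa [hlen₁, show 2 * s - j + (d + j) = s + (d + s) by omega]) h₁
      have hA₂' : A₂ = A₀.drop j ∨ ∃ a, A₂ = List.range' a (2 * s - j) := by
        rcases hA₂ with rfl | ⟨a, rfl⟩
        exacts [hA₁, Or.inr ⟨a, by rw [hlen₁]⟩]
      have hlen₂ : A₂.length = 2 * s - j := by
        rcases hA₂' with rfl | ⟨a, rfl⟩ <;> simp [hlen₀]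
      have hsup₂ : Superincreasing A₂ := by
        rcases hA₂' with rfl | ⟨a, rfl⟩
        exacts [hsup₀.drop j, .range' _ _]
      refine ⟨A₂.tail, ?_, ?_⟩
      · have := h₂.pop_superincreasing (N := s + (d + s))
          (List.length_pos_iff.1 (by omega)) hsup₂ (by omega) hk
        simpa [rightArm] using this
      · rcases hA₂' with rfl | ⟨a, rfl⟩
        · exact Or.inl List.tail_drop
        · exact Or.inr ⟨a + 1, by rw [List.tail_range', Nat.sub_sub]⟩
  obtain ⟨A', h', hA'⟩ := loop s le_rfl
  refine ⟨A', by simpa [toList_Z_add] using h', Or.inr ?_⟩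
  rcases hA' with rfl | ⟨a, rfl⟩
  -- The `s` minuses have used up exactly the old `A`, leaving the interval of new pluses.
  · exact ⟨w.length, by rw [hA₀, hs, List.drop_left]⟩
  · exact ⟨a, by rw [show 2 * s - s = s by omega]⟩

/-- The width of `Z(n)` is at most polylogarithmic in `n`. -/
theorem width_Z_le (n : ℕ) : width (Z n) ≤ (Nat.log 2 n + 2) ^ 2 := by
  obtain ⟨A, h, hA⟩ := Reach.append_Z (k := cost n) n (w := []) (B := []) .nil
    (by simp [runs_nil]) ⟨[], .nil _⟩
  have hA' : A = [] := by
    rcases hA with rfl | ⟨a, rfl⟩ <;> simp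
  subst hA'
  exact Reach.width_le (k := cost n) (by simpa using h)

end BracketRepairing

theorem mainTheorem5 :
    ∃ C : ℝ, ∀ n : ℕ, 2 ≤ n →
      (BracketRepairing.width (BracketRepairing.Z n) : ℝ) ≤
        (2 : ℝ) ^ (C * Real.sqrt (Real.logb 2 (n : ℝ))) := by
  -- With `x = √(log₂ n)`, `x ^ 2 + 2 ≤ (x + 1) ^ 4` and Bernoulli's `x + 1 ≤ 2 ^ x`; squaring gives
  -- the exponent 8.
  refine ⟨8, fun n hn => ?_⟩
  set L := Real.logb 2 (n : ℝ) with hL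
  set x := Real.sqrt L with hx
  have hn' : (2 : ℝ) ≤ n := by exact_mod_cast hn
  have hL1 : 1 ≤ L := by
    rw [hL, Real.le_logb_iff_rpow_le (by norm_num) (by linarith)]
    simpa using hn'
  have hx1 : 1 ≤ x := Real.one_le_sqrt.2 hL1
  have hxL : x ^ 2 = L := Real.sq_sqrt (by linarith)
  have hlog : (Nat.log 2 n : ℝ) ≤ L := by
    simpa using Real.natLog_le_logb n 2
  have hpow : x + 1 ≤ (2 : ℝ) ^ x := by
    have := one_add_mul_self_le_rpow_one_add (s := 1) (by norm_num) hx1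
    norm_num at this
    linarith
  have h8 : (2 : ℝ) ^ (8 * x) = ((2 : ℝ) ^ x) ^ 8 := by
    rw [mul_comm, Real.rpow_mul (by norm_num)]
    exact_mod_cast Real.rpow_natCast _ 8
  calc (BracketRepairing.width (BracketRepairing.Z n) : ℝ)
      ≤ ((Nat.log 2 n : ℝ) + 2) ^ 2 := by exact_mod_cast BracketRepairing.width_Z_le n
    _ ≤ (x ^ 2 + 2) ^ 2 := by rw [hxL]; gcongr
    _ ≤ ((x + 1) ^ 4) ^ 2 := by
        gcongr
        nlinarith [sq_nonneg (x ^ 2), pow_pos (by linarith : 0 < x) 3]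
    _ = (x + 1) ^ 8 := by ring
    _ ≤ ((2 : ℝ) ^ x) ^ 8 := by gcongr
    _ = (2 : ℝ) ^ (8 * x) := h8.symm
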